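/- Let $k$ be an algebraically closed field of characteristic $0$, let $N\ge 1$ and $n\ge 1$ be integers, and let $R=k[x_0,\dots,x_N]$ be the homogeneous coordinate ring of $\mathbb P^N_k$. For a finite set of points $X\subseteq\mathbb P^N_k$ let $I_X\subseteq R$ be the ideal of all polynomials vanishing on $X$. For an ideal $I\subseteq R$ and $m\ge 1$ let $I^{(m)}=\bigcap_{p}\,(I^mR_p\cap R)$, where $p$ runs over the associated primes of $R/I$, and let $\alpha(I)$ be the least degree of a nonzero polynomial in $I$. A property is said to hold for $n$ very general points in $\mathbb P^N_k$ if there are countably many dense Zariski-open subsets $U_0,U_1,U_2,\dots$ of the symmetric product $\mathrm{Sym}^n(\mathbb P^N_k)=(\mathbb P^N_k)^n/S_n$ (the Chow variety of $0$-cycles of degree $n$) such that $W=\bigcap_{i}U_i$ is nonempty and the property holds for every cycle $p_1+\dots+p_n\in W$. Theorem. The following holds for $n$ very general points $p_1,\dots,p_n$ in $\mathbb P^N_k$: the points are pairwise distinct, and the ideal $I=I_X$ of $X=\{p_1,\dots,p_n\}$ satisfies Chudnovsky's conjecture, that is, $$\frac{\alpha(I^{(m)})}{m}\;\ge\;\frac{\alpha(I)+N-1}{N}\qquad\text{for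 all } m\ge 1 .$$ -/

import Mathlib

open scoped LinearAlgebra.Projectivization

noncomputable section

namespace Chudnovsky

/-- Projective space `ℙ^N` over `k`: nonzero vectors of `k^(N+1)` up to scaling. -/
abbrev PSpace (k : Type*) [Field k] (N : ℕ) : Type _ := ℙ k (Fin (N + 1) → k)

/-- The ideal of `k[x_0, …, x_N]` of all polynomials that vanish on the set `X ⊆ ℙ^N`, that is, at
every vector of homogeneous coordinates of every point of `X`. -/
def definingIdeal {k : Type*} [Field k] {N : ℕ} (X : Set (PSpace k N)) :
    Ideal (MvPolynomial (Fin (N + 1)) k) :=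
  MvPolynomial.vanishingIdeal k
    {v : Fin (N + 1) → k | ∃ hv : v ≠ 0, Projectivization.mk k v hv ∈ X}

/-- The symbolic power `I^(m) = ⋂_p (I^m R_p ∩ R)`, where `p` runs over the associated primes of
`R / I`. -/
def symbolicPower {R : Type*} [CommRing R] (I : Ideal R) (m : ℕ) : Ideal R :=
  ⨅ (p : Ideal R) (hp : p ∈ associatedPrimes R (R ⧸ I)),
    haveI : p.IsPrime := IsAssociatedPrime.isPrime hp
    ((I ^ m).map (algebraMap R (Localization.AtPrime p))).comap
      (algebraMap R (Localization.AtPrime p))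

/-- The initial degree `α(I)`: the least degree of a nonzero polynomial in `I`. -/
def initialDegree {k : Type*} [Field k] {N : ℕ}
    (I : Ideal (MvPolynomial (Fin (N + 1)) k)) : ℕ :=
  sInf {d : ℕ | ∃ f ∈ I, f ≠ 0 ∧ f.totalDegree = d}

/-- `I` satisfies Chudnovsky's conjecture: `α(I^(m)) / m ≥ (α(I) + N - 1) / N` for all `m ≥ 1`. -/
def SatisfiesChudnovsky {k : Type*} [Field k] {N : ℕ}
    (I : Ideal (MvPolynomial (Fin (N + 1)) k)) : Prop :=
  ∀ m : ℕ, 1 ≤ m →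
    (initialDegree (symbolicPower I m) : ℝ) / m ≥ ((initialDegree I : ℝ) + N - 1) / N

/-- `f ∈ k[z_ij]` (`i < n`, `j ≤ N`) is homogeneous of degree `d i` in each group of variables
`z_i0, …, z_iN`. -/
def IsMultihomogeneous {k : Type*} [Field k] {n N : ℕ}
    (f : MvPolynomial (Fin n × Fin (N + 1)) k) (d : Fin n → ℕ) : Prop :=
  ∀ i : Fin n,
    MvPolynomial.IsWeightedHomogeneous
      (fun ij : Fin n × Fin (N + 1) => if ij.1 = i then 1 else 0) f (d i)

/-- The set of all `(p_1, …, p_n) ∈ (ℙ^N)^n` at which `f` does not vanish. For a multihomogeneous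
`f` the choice of homogeneous coordinates is immaterial. -/
def basicOpen {k : Type*} [Field k] {n N : ℕ}
    (f : MvPolynomial (Fin n × Fin (N + 1)) k) : Set (Fin n → PSpace k N) :=
  {P | MvPolynomial.eval (fun ij => (P ij.1).rep ij.2) f ≠ 0}

/-- The Zariski topology of the variety `ℙ^N × ⋯ × ℙ^N` (`n` factors; not the product topology):
the open sets are the unions of nonvanishing loci of multihomogeneous polynomials (these loci are
stable under finite intersections). -/
@[reducible] def zariskiTopologyProd (k : Type*) [Field k] (n N : ℕ) :
    TopologicalSpace (Fin n → PSpace k N) :=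
  TopologicalSpace.generateFrom
    {B | ∃ (f : MvPolynomial (Fin n × Fin (N + 1)) k) (d : Fin n → ℕ),
      IsMultihomogeneous f d ∧ B = basicOpen f}

/-- The `0`-cycle `p_1 + ⋯ + p_n`, as a point of the symmetric product. -/
def cycle {k : Type*} [Field k] {n N : ℕ} (P : Fin n → PSpace k N) : Sym (PSpace k N) n :=
  ⟨Finset.univ.val.map P, by simp⟩

/-- The Zariski topology of `Sym^n(ℙ^N) = (ℙ^N)^n / S_n`, the Chow variety of `0`-cycles of degree
`n` in `ℙ^N`: the quotient topology. -/
@[reducible] def zariskiTopologySym (k : Type*) [Field k] (n N : ℕ) :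
    TopologicalSpace (Sym (PSpace k N) n) :=
  TopologicalSpace.coinduced cycle (zariskiTopologyProd k n N)

/-- The property `Q` of `0`-cycles of degree `n` holds for `n` very general points of `ℙ^N`: it
holds on a nonempty set that is the intersection of countably many dense Zariski-open sets. -/
def HoldsForVeryGeneralPoints (k : Type*) [Field k] (n N : ℕ)
    (Q : Sym (PSpace k N) n → Prop) : Prop :=
  ∃ U : ℕ → Set (Sym (PSpace k N) n),
    (∀ i, @IsOpen _ (zariskiTopologySym k n N) (U i)) ∧
    (∀ i, @Dense _ (zariskiTopologySym k n N) (U i)) ∧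
    (⋂ i, U i).Nonempty ∧
    ∀ z ∈ ⋂ i, U i, Q z

end Chudnovsky

end

/-! Choose `β` with `(N+β-1).choose N ≤ n < (N+β).choose N` and put `s = N+β-1`. There are more
monomials of degree `β` than points, so `α(I) ≤ β` for any `n` points (`exists_form_mem_lineIdeal`).
It is therefore enough that `α(I^(m)) ≥ m * s / N` for every `m`.

For fixed `m` this bound follows once no nonzero form of one suitable degree vanishes to order `m`
at all the points: elements of `I^(m)` do vanish to order `m`
(`vanishesToOrder_of_mem_symbolicPower`), and a form of smaller degree can be multiplied up. Absence
of such forms means that a linear system has full rank, which is an open condition on the points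
(`isOpen_noFormVanishing`). Irreducibility of `(ℙ^N)^n` makes nonempty open sets dense. So a single
configuration that is good for all `m` proves that every open set, and also their intersection, is
nonempty.

That configuration is a star configuration, the `s.choose N` intersection points of `s` general
hyperplanes, padded with arbitrary points up to `n` (`exists_starConfiguration`). Its bound is
`mul_card_le_of_starConfiguration`. Either the polynomial survives restriction to one of the
hyperplanes, where the configuration induces a star configuration one dimension lower, or it is
divisible by all the linear forms. In the second case, dividing them out lowers the order at each
point by `N` and the degree by `s`.

An explicit model keeps this elementary: vectors of `k^(N+1)` are univariate polynomials of degree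
at most `N`, hyperplanes are the conditions `p(t) = 0` for `t ∈ T`, and the points are the products
of `N` distinct factors `X - a` with `a ∈ T`. -/

namespace Chudnovsky

/-! ### Star configurations and their degree bound -/

section Star

open MvPolynomial

variable {k : Type*} [Field k] {σ τ : Type*}

/-- The expansion `f (v T + Y t)` of `f` along the line spanned by `v`, as a polynomial in `t` over
`k[Y, T]`, the variable `T` being `X none`. -/
noncomputable def taylorLine (v : σ → k) :
    MvPolynomial σ k →+* Polynomial (MvPolynomial (Option σ) k) :=
  eval₂Hom (Polynomial.C.comp C)
    fun j => Polynomial.C (C (v j) * X none) + Polynomial.C (X (some j)) * Polynomial.X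

@[simp]
theorem taylorLine_C (v : σ → k) (a : k) : taylorLine v (C a) = Polynomial.C (C a) := by
  simp [taylorLine]

@[simp]
theorem taylorLine_X (v : σ → k) (j : σ) : taylorLine v (X j) =
    Polynomial.C (C (v j) * X none) + Polynomial.C (X (some j)) * Polynomial.X := by
  simp [taylorLine]

theorem coeff_zero_taylorLine (v : σ → k) (f : MvPolynomial σ k) :
    (taylorLine v f).coeff 0 = aeval (fun j => C (v j) * X none) f := by
  induction f using MvPolynomial.induction_on with
  | C a => simp [algebraMap_eq]
  | add p q hp hq => simp only [map_add, Polynomial.coeff_add, hp, hq]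
  | mul_X p j hp => simp [Polynomial.mul_coeff_zero, hp]

/-- The substitution of linear forms given by the rows of the matrix `M`. -/
noncomputable def linearSubst [Fintype τ] (M : σ → τ → k) :
    MvPolynomial σ k →ₐ[k] MvPolynomial τ k :=
  aeval fun j => ∑ i, C (M j i) * X i

@[simp]
theorem linearSubst_C [Fintype τ] (M : σ → τ → k) (a : k) : linearSubst M (C a) = C a := by
  simp [linearSubst, algebraMap_eq]

@[simp]
theorem linearSubst_X [Fintype τ] (M : σ → τ → k) (j : σ) :
    linearSubst M (X j) = ∑ i, C (M j i) * X i := by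
  simp [linearSubst]

theorem totalDegree_linearSubst_le [Fintype τ] (M : σ → τ → k) (f : MvPolynomial σ k) :
    (linearSubst M f).totalDegree ≤ f.totalDegree := by
  rw [linearSubst, aeval_def, eval₂_eq]
  refine totalDegree_finsetSum_le fun d hd => ?_
  refine (totalDegree_mul _ _).trans ?_
  rw [algebraMap_eq, totalDegree_C, zero_add]
  refine le_trans (totalDegree_finsetProd _ _) ?_
  refine le_trans (Finset.sum_le_sum fun i _ => (totalDegree_pow _ _).trans ?_) (le_totalDegree hd)
  refine (Nat.mul_le_mul_left _ (totalDegree_finsetSum_le (d := 1) fun j _ => ?_)).trans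
    (mul_one _).le
  refine (totalDegree_mul _ _).trans ?_
  simp

/-- By linearity, `M (v T + Y t) = (M v) T + (M Y) t`. Hence the order of vanishing along the line
of `M v` cannot drop on pulling back to the line of `v`. -/
theorem taylorLine_linearSubst [Fintype τ] (M : σ → τ → k) (v : τ → k) (f : MvPolynomial σ k) :
    taylorLine v (linearSubst M f) =
      Polynomial.mapRingHom (eval₂Hom C fun o : Option σ => o.elim (X none)
        fun j => ∑ i, C (M j i) * X (some i))
        (taylorLine (fun j => ∑ i, M j i * v i) f) := by
  induction f using MvPolynomial.induction_on with
  | C a => simp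
  | add p q hp hq => simp only [map_add, hp, hq]
  | mul_X p j hp =>
    have hX : taylorLine v (linearSubst M (X j)) =
        Polynomial.mapRingHom (eval₂Hom C fun o : Option σ => o.elim (X none)
          fun j => ∑ i, C (M j i) * X (some i)) (taylorLine (fun j => ∑ i, M j i * v i) (X j)) := by
      rw [linearSubst_X, taylorLine_X, map_sum]
      simp only [map_add, map_mul, map_sum, taylorLine_X, taylorLine_C, mul_add,
        Finset.sum_add_distrib, Finset.sum_mul, Polynomial.coe_mapRingHom, Polynomial.map_C,
        Polynomial.map_X, eval₂Hom_X', eval₂Hom_C, Option.elim_none, Option.elim_some, mul_assoc]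
    simp only [map_mul, hp, hX]

theorem pow_dvd_taylorLine_linearSubst [Fintype τ] {M : σ → τ → k} {v : τ → k} {m : ℕ}
    {f : MvPolynomial σ k}
    (h : Polynomial.X ^ m ∣ taylorLine (fun j => ∑ i, M j i * v i) f) :
    Polynomial.X ^ m ∣ taylorLine v (linearSubst M f) := by
  rw [taylorLine_linearSubst]
  simpa using map_dvd (Polynomial.mapRingHom (eval₂Hom C fun o : Option σ => o.elim (X none)
        fun j => ∑ i, C (M j i) * X (some i))) h

/-- The linear form `∑ t ^ j x_j`. Viewing a vector as the coefficients of a univariate polynomial,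
it is evaluation at `t`. -/
noncomputable def evalForm (n : ℕ) (t : k) : MvPolynomial (Fin n) k :=
  ∑ j : Fin n, C (t ^ (j : ℕ)) * X j

/-- The coefficient vector of `∏ a ∈ S, (X - a)`. -/
noncomputable def starPoint (N : ℕ) (S : Finset k) (j : Fin (N + 1)) : k :=
  (∏ a ∈ S, (Polynomial.X - Polynomial.C a)).coeff j

/-- The matrix of multiplication by `X - t` on univariate polynomials. -/
noncomputable def mulMatrix {m n : ℕ} (t : k) (j : Fin m) (i : Fin n) : k :=
  ((Polynomial.X - Polynomial.C t) * Polynomial.X ^ (i : ℕ)).coeff j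

theorem sum_coeff_mul_coeff {n : ℕ} (p q : Polynomial k) (hq : q.natDegree < n) (j : ℕ) :
    ∑ i : Fin n, (p * Polynomial.X ^ (i : ℕ)).coeff j * q.coeff i = (p * q).coeff j := by
  conv_rhs => rw [q.as_sum_range' n hq, Finset.mul_sum, Polynomial.finsetSum_coeff]
  rw [Finset.sum_range]
  refine Finset.sum_congr rfl fun i _ => ?_
  rw [← Polynomial.C_mul_X_pow_eq_monomial, mul_left_comm, Polynomial.coeff_C_mul, mul_comm]

theorem natDegree_prod_X_sub_C (S : Finset k) :
    (∏ a ∈ S, (Polynomial.X - Polynomial.C a)).natDegree = S.card := by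
  simp

/-- Multiplication by `X - t` parametrizes the hyperplane `p(t) = 0`; this identifies the star
points on it with those of a star configuration one dimension lower. -/
theorem mulMatrix_starPoint [DecidableEq k] {N : ℕ} {S : Finset k} {t : k} (ht : t ∉ S)
    (hS : S.card = N)
    (j : Fin (N + 2)) :
    ∑ i, mulMatrix t j i * starPoint N S i = starPoint (N + 1) (insert t S) j := by
  simp only [mulMatrix, starPoint]
  rw [sum_coeff_mul_coeff _ _ (by rw [natDegree_prod_X_sub_C]; omega), Finset.prod_insert ht]

theorem eval_evalForm_starPoint {N : ℕ} {S : Finset k} (hS : S.card = N) (t : k) :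
    eval (starPoint N S) (evalForm (N + 1) t) = ∏ a ∈ S, (t - a) := by
  have h := Polynomial.eval_eq_sum_range' (p := ∏ a ∈ S, (Polynomial.X - Polynomial.C a))
    (n := N + 1) (by rw [natDegree_prod_X_sub_C]; omega) t
  rw [Polynomial.eval_prod, Finset.sum_range] at h
  simp only [Polynomial.eval_sub, Polynomial.eval_X, Polynomial.eval_C] at h
  rw [h]
  simp [evalForm, starPoint, mul_comm]

theorem linearSubst_mulMatrix_evalForm {N : ℕ} (t u : k) :
    linearSubst (mulMatrix t : Fin (N + 2) → Fin (N + 1) → k) (evalForm (N + 2) u) =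
      C (u - t) * evalForm (N + 1) u := by
  simp only [linearSubst_X, linearSubst_C, evalForm, map_sum, map_mul, Finset.mul_sum]
  rw [Finset.sum_comm]
  refine Finset.sum_congr rfl fun i _ => ?_
  simp only [← mul_assoc, ← map_mul, ← Finset.sum_mul, ← map_sum]
  congr 2
  have h := Polynomial.eval_eq_sum_range' (n := N + 2)
    (p := (Polynomial.X - Polynomial.C t) * Polynomial.X ^ (i : ℕ)) (by
      refine (Polynomial.natDegree_mul_le).trans_lt ?_
      rw [Polynomial.natDegree_X_sub_C, Polynomial.natDegree_X_pow]
      omega) u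
  rw [Finset.sum_range] at h
  simp only [Polynomial.eval_mul, Polynomial.eval_sub, Polynomial.eval_X, Polynomial.eval_C,
    Polynomial.eval_pow] at h
  rw [h]
  exact Finset.sum_congr rfl fun j _ => mul_comm _ _

/-- Division with remainder by `X - t` retracts the whole space onto the hyperplane `p(t) = 0`. The
retraction changes coordinates only by multiples of `evalForm t`, so `f` is congruent modulo
`evalForm t` to a polynomial determined by its restriction. -/
theorem evalForm_dvd_of_linearSubst_eq_zero {N : ℕ} {t : k} {f : MvPolynomial (Fin (N + 2)) k}
    (hf : linearSubst (mulMatrix t : Fin (N + 2) → Fin (N + 1) → k) f = 0) :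
    evalForm (N + 2) t ∣ f := by
  -- `B` is the matrix of the quotient on division by `X - t`; the remainder `p(t)` affects only the
  -- constant coefficient.
  set B : Fin (N + 1) → Fin (N + 2) → k := fun i l =>
    ((Polynomial.X ^ (l : ℕ) : Polynomial k) /ₘ (Polynomial.X - Polynomial.C t)).coeff i with hB
  have hX : ∀ j : Fin (N + 2),
      linearSubst B (linearSubst (mulMatrix t : Fin (N + 2) → Fin (N + 1) → k) (X j)) =
        X j - C (if (j : ℕ) = 0 then 1 else 0) * evalForm (N + 2) t := by
    intro j
    have key : ∀ l : Fin (N + 2), ∑ i : Fin (N + 1), mulMatrix t j i * B i l =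
        (if j = l then 1 else 0) - (if (j : ℕ) = 0 then 1 else 0) * t ^ (l : ℕ) := by
      intro l
      simp only [mulMatrix, hB]
      rw [sum_coeff_mul_coeff _ _ (by
        rw [Polynomial.natDegree_divByMonic _ (Polynomial.monic_X_sub_C t),
          Polynomial.natDegree_X_pow, Polynomial.natDegree_X_sub_C]; omega)]
      rw [← sub_eq_of_eq_add' (Polynomial.modByMonic_add_div (Polynomial.X ^ (l : ℕ))
        (Polynomial.X - Polynomial.C t)).symm, Polynomial.modByMonic_X_sub_C_eq_C_eval,
        Polynomial.coeff_sub, Polynomial.coeff_X_pow, Polynomial.coeff_C]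
      rw [Polynomial.eval_pow, Polynomial.eval_X, ite_mul, one_mul, zero_mul]
      simp only [Fin.ext_iff]
    have h1 : linearSubst B (linearSubst (mulMatrix t : Fin (N + 2) → Fin (N + 1) → k) (X j)) =
        ∑ l, C (∑ i : Fin (N + 1), mulMatrix t j i * B i l) * X l := by
      simp only [linearSubst_X, linearSubst_C, map_sum, map_mul, Finset.mul_sum,
        Finset.sum_mul, mul_assoc]
      rw [Finset.sum_comm]
    rw [h1, evalForm, Finset.mul_sum]
    simp only [key, map_sub, sub_mul, Finset.sum_sub_distrib, map_mul, mul_assoc]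
    congr 1
    simp
  have hmod : ∀ g : MvPolynomial (Fin (N + 2)) k, evalForm (N + 2) t ∣
      g - linearSubst B (linearSubst (mulMatrix t : Fin (N + 2) → Fin (N + 1) → k) g) := by
    intro g
    induction g using MvPolynomial.induction_on with
    | C a => simp
    | add p q hp hq =>
      rw [map_add, map_add, add_sub_add_comm]
      exact dvd_add hp hq
    | mul_X p j hp =>
      rw [map_mul, map_mul, hX]
      set q := linearSubst B (linearSubst (mulMatrix t : Fin (N + 2) → Fin (N + 1) → k) p)
      set c : MvPolynomial (Fin (N + 2)) k := C (if (j : ℕ) = 0 then 1 else 0)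
      have : p * X j - q * (X j - c * evalForm (N + 2) t) =
          (p - q) * X j + evalForm (N + 2) t * (q * c) := by ring
      rw [this]
      exact dvd_add (hp.mul_right _) (dvd_mul_right _ _)
  simpa [hf] using hmod f

theorem evalForm_ne_zero (n : ℕ) (t : k) : evalForm (n + 1) t ≠ 0 := by
  intro h
  have h2 := congrArg (eval (Pi.single 0 1 : Fin (n + 1) → k)) h
  simp [evalForm, Pi.single_apply] at h2

/-- The factors can be split off one at a time: for `u ≠ t`, the form of `u` restricts to the
nonzero multiple `u - t` of a nonzero form on the hyperplane of `t`, so the cofactor must vanish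
there. -/
theorem prod_evalForm_dvd {N : ℕ} (T : Finset k) {f : MvPolynomial (Fin (N + 2)) k}
    (hf : ∀ t ∈ T, linearSubst (mulMatrix t : Fin (N + 2) → Fin (N + 1) → k) f = 0) :
    ∏ t ∈ T, evalForm (N + 2) t ∣ f := by
  classical
  induction T using Finset.induction_on with
  | empty => simp
  | insert t T ht ih =>
    obtain ⟨g, rfl⟩ := ih fun u hu => hf u (Finset.mem_insert_of_mem hu)
    have h := hf t (Finset.mem_insert_self _ _)
    rw [map_mul, map_prod, mul_eq_zero, Finset.prod_eq_zero_iff] at h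
    obtain ⟨u, hu, h0⟩ | h := h
    · rw [linearSubst_mulMatrix_evalForm, mul_eq_zero] at h0
      obtain h0 | h0 := h0
      · rw [C_eq_zero, sub_eq_zero] at h0
        exact absurd (h0 ▸ hu) ht
      · exact absurd h0 (evalForm_ne_zero _ _)
    · rw [Finset.prod_insert ht, mul_comm]
      exact mul_dvd_mul_left _ (evalForm_dvd_of_linearSubst_eq_zero h)

theorem totalDegree_prod_evalForm_mul {n : ℕ} (T : Finset k) {g : MvPolynomial (Fin (n + 1)) k}
    (hg : g ≠ 0) :
    ((∏ t ∈ T, evalForm (n + 1) t) * g).totalDegree = T.card + g.totalDegree := by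
  have h0 : ∏ t ∈ T, evalForm (n + 1) t ≠ 0 :=
    Finset.prod_ne_zero_iff.2 fun t _ => evalForm_ne_zero n t
  rw [totalDegree_mul_of_isDomain h0 hg]
  congr 1
  have h : (∏ t ∈ T, evalForm (n + 1) t).IsHomogeneous (∑ _t ∈ T, 1) :=
    IsHomogeneous.prod _ _ _ fun t _ => IsHomogeneous.sum _ _ _ fun j _ =>
      isHomogeneous_C_mul_X _ _
  rw [h.totalDegree h0]
  simp

theorem taylorLine_evalForm {n : ℕ} (v : Fin n → k) (t : k) :
    taylorLine v (evalForm n t) = Polynomial.C (C (eval v (evalForm n t)) * X none) +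
      Polynomial.C (rename some (evalForm n t)) * Polynomial.X := by
  simp [evalForm, Finset.sum_mul, Finset.sum_add_distrib, mul_add, mul_assoc]

theorem not_X_dvd_taylorLine_evalForm {n : ℕ} {v : Fin n → k} {t : k}
    (h : eval v (evalForm n t) ≠ 0) : ¬ Polynomial.X ∣ taylorLine v (evalForm n t) := by
  rw [taylorLine_evalForm, Polynomial.X_dvd_iff]
  simp [h]

/-- Exactly `N` of the hyperplanes, those indexed by `S`, pass through the point of `S`. Each
contributes one factor `X`, and the other linear forms are units at the point as far as divisibility
by the prime `X` is concerned. -/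
theorem X_pow_dvd_taylorLine_of_prod_mul {N : ℕ} {S T : Finset k} (hST : S ⊆ T) (hS : S.card = N)
    {m : ℕ} {g : MvPolynomial (Fin (N + 1)) k}
    (h : Polynomial.X ^ (N + m) ∣
      taylorLine (starPoint N S) ((∏ t ∈ T, evalForm (N + 1) t) * g)) :
    Polynomial.X ^ m ∣ taylorLine (starPoint N S) g := by
  classical
  have hX := Polynomial.prime_X (R := MvPolynomial (Option (Fin (N + 1))) k)
  have h1 : taylorLine (starPoint N S) (∏ t ∈ S, evalForm (N + 1) t) =
      Polynomial.X ^ N * Polynomial.C (∏ t ∈ S, rename some (evalForm (N + 1) t)) := by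
    rw [map_prod]
    have h2 : (Polynomial.X : Polynomial (MvPolynomial (Option (Fin (N + 1))) k)) ^ N =
        ∏ _t ∈ S, Polynomial.X := by rw [Finset.prod_const, hS]
    rw [h2, map_prod, ← Finset.prod_mul_distrib]
    refine Finset.prod_congr rfl fun t ht => ?_
    rw [taylorLine_evalForm, eval_evalForm_starPoint hS, Finset.prod_eq_zero ht (sub_self t), C_0, zero_mul,
      Polynomial.C_0, zero_add, mul_comm]
  have h3 : taylorLine (starPoint N S) ((∏ t ∈ T, evalForm (N + 1) t) * g) =
      Polynomial.X ^ N * ((∏ t ∈ T \ S, taylorLine (starPoint N S) (evalForm (N + 1) t)) *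
        Polynomial.C (∏ t ∈ S, rename some (evalForm (N + 1) t)) *
          taylorLine (starPoint N S) g) := by
    rw [← Finset.prod_sdiff hST, map_mul, map_mul, h1, map_prod]
    ring
  rw [h3, pow_add] at h
  have h2 := (mul_dvd_mul_iff_left (pow_ne_zero N hX.ne_zero)).1 h
  refine hX.pow_dvd_of_dvd_mul_left _ (fun h3 => ?_) h2
  obtain h3 | h3 := hX.dvd_or_dvd h3
  · obtain ⟨t, ht, h4⟩ := hX.exists_mem_finset_dvd h3
    refine not_X_dvd_taylorLine_evalForm ?_ h4
    rw [eval_evalForm_starPoint hS, Finset.prod_ne_zero_iff]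
    intro a ha h0
    rw [sub_eq_zero] at h0
    exact (Finset.mem_sdiff.1 ht).2 (h0 ▸ ha)
  · rw [Polynomial.X_dvd_iff, Polynomial.coeff_C_zero, Finset.prod_eq_zero_iff] at h3
    obtain ⟨t, -, h4⟩ := h3
    exact evalForm_ne_zero N t ((map_eq_zero_iff _ (rename_injective _ (Option.some_injective _))).1 h4)

/-- Chudnovsky's bound for star configurations: a nonzero polynomial vanishing to order `m` along
the lines of `k ^ (N + 1)` over all points of a star configuration of `T.card` hyperplanes has
degree at least `m * T.card / N`. -/
theorem mul_card_le_of_starConfiguration (N : ℕ) (T : Finset k) (m : ℕ)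
    (f : MvPolynomial (Fin (N + 1)) k) (hT : N ≤ T.card) (hm : 1 ≤ m) (hf : f ≠ 0)
    (h : ∀ S ⊆ T, S.card = N → Polynomial.X ^ m ∣ taylorLine (starPoint N S) f) :
    1 ≤ N ∧ m * T.card ≤ N * f.totalDegree := by
  classical
  induction N generalizing T m with
  | zero =>
    -- In `ℙ^0` the empty product gives the only point, and vanishing there to positive order forces
    -- `f = 0`. The conclusion `1 ≤ N` records that this case cannot occur.
    refine absurd ?_ hf
    have hs : Subsingleton (Fin (0 + 1)) := inferInstanceAs (Subsingleton (Fin 1))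
    have h1 := (dvd_pow_self Polynomial.X (by omega)).trans (h ∅ (Finset.empty_subset _) rfl)
    rw [Polynomial.X_dvd_iff, coeff_zero_taylorLine] at h1
    have h2 : (fun j => C (starPoint 0 (∅ : Finset k) j) * X none :
        Fin (0 + 1) → MvPolynomial (Option (Fin (0 + 1))) k) = fun j => X none := by
      funext j
      have : j = 0 := Subsingleton.elim _ _
      simp [this, starPoint]
    have h3 : (aeval fun _ : Fin (0 + 1) => X none :
        _ →ₐ[k] MvPolynomial (Option (Fin (0 + 1))) k) = rename fun _ => none := by
      ext j
      simp
    rw [h2, h3] at h1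
    exact rename_injective (fun _ : Fin (0 + 1) => none)
      (Function.injective_of_subsingleton _) (h1.trans (map_zero _).symm)
  | succ N ih =>
    refine ⟨by omega, ?_⟩
    induction m using Nat.strong_induction_on generalizing f with
    | _ m ihm =>
    -- Either some restriction is nonzero and the dimension drops, or all linear forms divide `f`
    -- and the order `m` drops.
    by_cases hA : ∃ t ∈ T, linearSubst (mulMatrix t : Fin (N + 2) → Fin (N + 1) → k) f ≠ 0
    · obtain ⟨t, ht, h0⟩ := hA
      have hc := Finset.card_erase_add_one ht
      obtain ⟨hN, hle⟩ := ih (T.erase t) m _ (by omega) hm h0 fun S hS hSN => by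
        have htS : t ∉ S := fun h => Finset.notMem_erase t T (hS h)
        apply pow_dvd_taylorLine_linearSubst
        have h1 := h (insert t S)
          (Finset.insert_subset ht (hS.trans (Finset.erase_subset _ _)))
          (by rw [Finset.card_insert_of_notMem htS, hSN])
        convert h1 using 3
        exact _root_.funext fun j => mulMatrix_starPoint htS hSN j
      have hd := Nat.mul_le_mul_left N (totalDegree_linearSubst_le
        (mulMatrix t : Fin (N + 2) → Fin (N + 1) → k) f)
      have hle' := hle.trans hd
      set c := (T.erase t).card
      rw [← hc]
      -- With `c = T.card - 1 ≥ N` one has `N * (c + 1) ≤ (N + 1) * c`, which turns the bound `m * c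
      -- / N` into `m * (c + 1) / (N + 1)`. Cancelling `N` needs the `1 ≤ N` supplied by the
      -- induction.
      have hNc : N ≤ c := by omega
      refine Nat.le_of_mul_le_mul_left ?_ (show 0 < N by omega)
      calc N * (m * (c + 1)) = m * (N * c + N) := by ring
        _ ≤ m * (N * c + c) := by gcongr
        _ = (N + 1) * (m * c) := by ring
        _ ≤ (N + 1) * (N * f.totalDegree) := by gcongr
        _ = N * ((N + 1) * f.totalDegree) := by ring
    · push Not at hA
      obtain ⟨g, rfl⟩ := prod_evalForm_dvd T hA
      have hg : g ≠ 0 := right_ne_zero_of_mul hf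
      rw [totalDegree_prod_evalForm_mul T hg]
      -- For small `m` the degree `T.card` of the product already suffices; otherwise the cofactor
      -- has positive order `m - (N + 1)` left for the induction.
      by_cases hmN : m ≤ N + 1
      · calc m * T.card ≤ (N + 1) * T.card := by gcongr
          _ ≤ _ := by gcongr; omega
      · obtain ⟨r, rfl⟩ := Nat.exists_eq_add_of_lt (not_le.1 hmN)
        have := ihm (r + 1) (by omega) g (by omega) hg fun S hS hSN =>
          X_pow_dvd_taylorLine_of_prod_mul hS hSN (by simpa only [add_assoc] using h S hS hSN)
        calc (N + 1 + r + 1) * T.card = (N + 1) * T.card + (r + 1) * T.card := by ring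
          _ ≤ (N + 1) * T.card + (N + 1) * g.totalDegree := by gcongr
          _ = _ := by ring

end Star

end Chudnovsky

namespace Chudnovsky

/-! ### Order of vanishing along a line, via partial derivatives -/

section Order

open MvPolynomial

variable {k : Type*} [Field k] {σ : Type*}

/-- Restriction of polynomials to the line spanned by `v`. -/
noncomputable def lineHom (v : σ → k) : MvPolynomial σ k →ₐ[k] Polynomial k :=
  aeval fun j => Polynomial.C (v j) * Polynomial.X

/-- The prime ideal of all polynomials that vanish on the line spanned by `v`. -/
noncomputable def lineIdeal (v : σ → k) : Ideal (MvPolynomial σ k) :=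
  RingHom.ker (lineHom v)

instance lineIdeal_isPrime (v : σ → k) : (lineIdeal v).IsPrime :=
  RingHom.ker_isPrime _

theorem mem_lineIdeal {v : σ → k} {f : MvPolynomial σ k} : f ∈ lineIdeal v ↔ lineHom v f = 0 :=
  RingHom.mem_ker

theorem coeff_lineHom (v : σ → k) (f : MvPolynomial σ k) (e : ℕ) :
    (lineHom v f).coeff e = eval v (homogeneousComponent e f) := by
  induction f using MvPolynomial.induction_on' with
  | add p q hp hq => simp only [map_add, Polynomial.coeff_add, hp, hq]
  | monomial d a =>
    have h : lineHom v (monomial d a) =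
        Polynomial.C (a * d.prod fun j r => v j ^ r) * Polynomial.X ^ d.degree := by
      rw [lineHom, aeval_monomial]
      simp only [mul_pow, Finsupp.prod, Finset.prod_mul_distrib, Finset.prod_pow_eq_pow_sum,
        map_mul, map_prod, map_pow, Polynomial.algebraMap_eq, mul_assoc]
      rfl
    rw [h, Polynomial.coeff_C_mul_X_pow,
      homogeneousComponent_of_mem (isHomogeneous_monomial a rfl : (monomial d a).IsHomogeneous _)]
    by_cases he : e = d.degree
    · rw [if_pos he, if_pos he, eval_monomial]
    · rw [if_neg he, if_neg he, map_zero]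

theorem eval_lineHom (v : σ → k) (f : MvPolynomial σ k) (c : k) :
    (lineHom v f).eval c = eval (c • v) f := by
  induction f using MvPolynomial.induction_on with
  | C a => simp [lineHom, ← algebraMap_eq]
  | add p q hp hq => simp only [map_add, Polynomial.eval_add, hp, hq]
  | mul_X p j hp => 
    rw [map_mul, Polynomial.eval_mul, hp, map_mul, eval_X, lineHom, aeval_X, Polynomial.eval_mul,
      Polynomial.eval_C, Polynomial.eval_X, Pi.smul_apply, smul_eq_mul, mul_comm c]

theorem mem_lineIdeal_iff_forall {v : σ → k} {f : MvPolynomial σ k} :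
    f ∈ lineIdeal v ↔ ∀ e, eval v (homogeneousComponent e f) = 0 := by
  rw [mem_lineIdeal, Polynomial.ext_iff]
  simp only [coeff_lineHom, Polynomial.coeff_zero]

theorem mem_lineIdeal_of_isHomogeneous {v : σ → k} {f : MvPolynomial σ k} {d : ℕ}
    (hf : f.IsHomogeneous d) : f ∈ lineIdeal v ↔ eval v f = 0 := by
  rw [mem_lineIdeal_iff_forall]
  constructor
  · intro h
    simpa [homogeneousComponent_of_mem hf] using h d
  · intro h e
    rw [homogeneousComponent_of_mem hf]
    split_ifs <;> simp [h]

theorem homogeneousComponent_mem_lineIdeal {v : σ → k} {f : MvPolynomial σ k}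
    (hf : f ∈ lineIdeal v) (e : ℕ) : homogeneousComponent e f ∈ lineIdeal v :=
  (mem_lineIdeal_of_isHomogeneous (homogeneousComponent_isHomogeneous e f)).2
    (mem_lineIdeal_iff_forall.1 hf e)

/-- The iterated partial derivative along a word in the variables. -/
noncomputable def iterPderiv : List σ → MvPolynomial σ k →ₗ[k] MvPolynomial σ k
  | [] => LinearMap.id
  | j :: w => iterPderiv w ∘ₗ (pderiv j).toLinearMap

theorem iterPderiv_isHomogeneous (w : List σ) {f : MvPolynomial σ k} {d : ℕ}
    (hf : f.IsHomogeneous d) : (iterPderiv w f).IsHomogeneous (d - w.length) := by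
  induction w generalizing f d with
  | nil => exact hf
  | cons j w ih =>
    rw [List.length_cons, add_comm, ← Nat.sub_sub]
    exact ih hf.pderiv

/-- All partial derivatives of `f` of order less than `m` lie in `P`. -/
def VanishesToOrder (P : Ideal (MvPolynomial σ k)) (m : ℕ) (f : MvPolynomial σ k) : Prop :=
  ∀ w : List σ, w.length < m → iterPderiv w f ∈ P

variable {P : Ideal (MvPolynomial σ k)} {m : ℕ} {f g : MvPolynomial σ k}

theorem vanishesToOrder_zero : VanishesToOrder P 0 f := fun _ hw => absurd hw (Nat.not_lt_zero _)

theorem vanishesToOrder_succ : VanishesToOrder P (m + 1) f ↔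
    f ∈ P ∧ ∀ j, VanishesToOrder P m (pderiv j f) := by
  constructor
  · intro h
    exact ⟨h [] (by simp), fun j w hw => h (j :: w) (by simpa using hw)⟩
  · rintro ⟨h0, h⟩ (_ | ⟨j, w⟩) hw
    · exact h0
    · exact h j w (by simpa using hw)

theorem VanishesToOrder.mono {n : ℕ} (h : VanishesToOrder P n f) (hmn : m ≤ n) :
    VanishesToOrder P m f := fun w hw => h w (hw.trans_le hmn)

theorem VanishesToOrder.add (hf : VanishesToOrder P m f) (hg : VanishesToOrder P m g) :
    VanishesToOrder P m (f + g) := fun w hw => by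
  rw [map_add]
  exact P.add_mem (hf w hw) (hg w hw)

theorem VanishesToOrder.sub (hf : VanishesToOrder P m f) (hg : VanishesToOrder P m g) :
    VanishesToOrder P m (f - g) := fun w hw => by
  rw [map_sub]
  exact P.sub_mem (hf w hw) (hg w hw)

theorem VanishesToOrder.mul_left (hf : VanishesToOrder P m f) (g : MvPolynomial σ k) :
    VanishesToOrder P m (g * f) := by
  induction m generalizing f g with
  | zero => exact vanishesToOrder_zero
  | succ m ih =>
    have hf' := hf.mono m.le_succ
    rw [vanishesToOrder_succ] at hf ⊢
    refine ⟨P.mul_mem_left _ hf.1, fun j => ?_⟩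
    rw [pderiv_mul]
    exact (ih hf' _).add (ih (hf.2 j) _)

theorem VanishesToOrder.mul_mem (hg : g ∈ P) (hf : VanishesToOrder P m f) :
    VanishesToOrder P (m + 1) (g * f) := by
  induction m generalizing f with
  | zero => exact vanishesToOrder_succ.2 ⟨P.mul_mem_right _ hg, fun _ => vanishesToOrder_zero⟩
  | succ m ih =>
    rw [vanishesToOrder_succ]
    refine ⟨P.mul_mem_right _ hg, fun j => ?_⟩
    rw [pderiv_mul]
    exact (hf.mul_left _).add (ih (vanishesToOrder_succ.1 hf |>.2 j))

theorem vanishesToOrder_of_mem_pow (hf : f ∈ P ^ m) : VanishesToOrder P m f := by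
  induction m generalizing f with
  | zero => exact vanishesToOrder_zero
  | succ m ih =>
    rw [pow_succ'] at hf
    refine Submodule.mul_induction_on hf (fun a ha b hb => (ih hb).mul_mem ha)
      fun _ _ => VanishesToOrder.add

/-- This replaces localization at `P`. By induction `f` already vanishes to order one less, so the
Leibniz term `pderiv j g * f` can be subtracted, leaving `g * pderiv j f` to which the induction
applies again. -/
theorem VanishesToOrder.of_mul [P.IsPrime] (hg : g ∉ P) (h : VanishesToOrder P m (g * f)) :
    VanishesToOrder P m f := by
  induction m generalizing f with
  | zero => exact vanishesToOrder_zero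
  | succ m ih =>
    have hf := ih (h.mono m.le_succ)
    rw [vanishesToOrder_succ] at h ⊢
    refine ⟨(Ideal.IsPrime.mem_or_mem ‹_› h.1).resolve_left hg, fun j => ih ?_⟩
    have := (h.2 j).sub (hf.mul_left (pderiv j g))
    rwa [pderiv_mul, add_sub_cancel_left] at this

theorem pderiv_homogeneousComponent_succ (j : σ) (e : ℕ) (f : MvPolynomial σ k) :
    pderiv j (homogeneousComponent (e + 1) f) = homogeneousComponent e (pderiv j f) := by
  classical
  ext d
  rw [coeff_pderiv, coeff_homogeneousComponent, coeff_homogeneousComponent, coeff_pderiv, map_add,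
    Finsupp.degree_single]
  simp only [add_left_inj, ite_mul, zero_mul]

/-- The ideal of a line through the origin is homogeneous and derivatives only shift the grading;
this allows passing from elements of a symbolic power to forms. -/
theorem VanishesToOrder.homogeneousComponent {v : σ → k}
    (h : VanishesToOrder (lineIdeal v) m f) (e : ℕ) :
    VanishesToOrder (lineIdeal v) m (homogeneousComponent e f) := by
  induction m generalizing f e with
  | zero => exact vanishesToOrder_zero
  | succ m ih =>
    rw [vanishesToOrder_succ] at h ⊢
    refine ⟨homogeneousComponent_mem_lineIdeal h.1 e, fun j => ?_⟩
    cases e with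
    | zero =>
      rw [homogeneousComponent_zero, pderiv_C]
      intro w _
      rw [map_zero]
      exact zero_mem _
    | succ e =>
      rw [pderiv_homogeneousComponent_succ]
      exact ih (h.2 j) e

theorem derivative_taylorLine [Fintype σ] (v : σ → k) (f : MvPolynomial σ k) :
    Polynomial.derivative (taylorLine v f) =
      ∑ j, Polynomial.C (X (some j)) * taylorLine v (pderiv j f) := by
  classical
  induction f using MvPolynomial.induction_on with
  | C a => simp
  | add p q hp hq => simp only [map_add, hp, hq, mul_add, Finset.sum_add_distrib]
  | mul_X p i hp =>
    rw [map_mul, Polynomial.derivative_mul, hp, Finset.sum_mul]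
    have h1 : Polynomial.derivative (taylorLine v (X i)) = Polynomial.C (X (some i)) := by simp
    have h2 : ∀ j, Polynomial.C (X (some j)) * taylorLine v (pderiv j (p * X i)) =
        Polynomial.C (X (some j)) * taylorLine v (pderiv j p) * taylorLine v (X i) +
          if j = i then taylorLine v p * Polynomial.C (X (some j)) else 0 := by
      intro j
      rw [pderiv_mul, map_add, map_mul, mul_add, mul_assoc, pderiv_X, Pi.single_apply]
      by_cases hj : i = j
      · rw [if_pos hj, if_pos hj.symm, mul_one, mul_comm (taylorLine v p)]
      · rw [if_neg hj, if_neg (Ne.symm hj), mul_zero, map_zero, mul_zero]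
    simp only [h1, h2, Finset.sum_add_distrib, Finset.sum_ite_eq', Finset.mem_univ, if_true]

theorem coeff_zero_taylorLine_of_mem {v : σ → k} (hf : f ∈ lineIdeal v) :
    (taylorLine v f).coeff 0 = 0 := by
  have h (f : MvPolynomial σ k) : aeval (fun j => C (v j) * X none) f =
      Polynomial.aeval (X none : MvPolynomial (Option σ) k) (lineHom v f) := by
    induction f using MvPolynomial.induction_on with
    | C a => simp [lineHom, ← algebraMap_eq]
    | add p q hp hq => simp only [map_add, hp, hq]
    | mul_X p j hp => simp only [map_mul, hp]; simp [lineHom, algebraMap_eq]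
  rw [coeff_zero_taylorLine, h, mem_lineIdeal.1 hf, map_zero]

theorem X_pow_succ_dvd_of_derivative {A : Type*} [CommRing A] [IsDomain A] [CharZero A]
    {p : Polynomial A} (h0 : p.coeff 0 = 0) (h : Polynomial.X ^ m ∣ Polynomial.derivative p) :
    Polynomial.X ^ (m + 1) ∣ p := by
  rw [Polynomial.X_pow_dvd_iff] at h ⊢
  rintro (_ | d) hd
  · exact h0
  · have := h d (by omega)
    rw [Polynomial.coeff_derivative] at this
    exact (mul_eq_zero.1 this).resolve_right (by exact_mod_cast Nat.succ_ne_zero d)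

/-- The chain rule expresses the derivative in `t` through the partials of `f`. In characteristic
`0` a series without constant term has order one more than its derivative. -/
theorem VanishesToOrder.X_pow_dvd_taylorLine [CharZero k] [Fintype σ] {v : σ → k}
    (h : VanishesToOrder (lineIdeal v) m f) : Polynomial.X ^ m ∣ taylorLine v f := by
  induction m generalizing f with
  | zero => simp
  | succ m ih =>
    rw [vanishesToOrder_succ] at h
    refine X_pow_succ_dvd_of_derivative (coeff_zero_taylorLine_of_mem h.1) ?_
    rw [derivative_taylorLine]
    exact Finset.dvd_sum fun j _ => (ih (h.2 j)).mul_left _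

end Order

/-! ### From symbolic powers to orders of vanishing -/

section SymbolicPower

open MvPolynomial

theorem pow_le_symbolicPower {R : Type*} [CommRing R] (I : Ideal R) (m : ℕ) :
    I ^ m ≤ symbolicPower I m :=
  le_iInf₂ fun _ _ => Ideal.le_comap_map

theorem exists_mul_mem_pow_of_mem_symbolicPower {R : Type*} [CommRing R] {I P : Ideal R} {m : ℕ}
    (hP : P ∈ associatedPrimes R (R ⧸ I)) {f : R} (hf : f ∈ symbolicPower I m) :
    ∃ s ∉ P, s * f ∈ I ^ m := by
  have : P.IsPrime := IsAssociatedPrime.isPrime hP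
  have h := (Submodule.mem_iInf _).1 ((Submodule.mem_iInf _).1 hf P) hP
  rw [Ideal.mem_comap, IsLocalization.algebraMap_mem_map_algebraMap_iff P.primeCompl] at h
  exact h

variable {k : Type*} [Field k] {N : ℕ}

theorem exists_rep_mul_rep_ne {p q : PSpace k N} (h : p ≠ q) :
    ∃ a b, p.rep a * q.rep b - p.rep b * q.rep a ≠ 0 := by
  by_contra! H
  obtain ⟨b, hb⟩ := Function.ne_iff.1 q.rep_nonzero
  refine h ?_
  rw [← p.mk_rep, ← q.mk_rep, Projectivization.mk_eq_mk_iff']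
  refine ⟨p.rep b / q.rep b, funext fun a => ?_⟩
  have hb : q.rep b ≠ 0 := hb
  have := H a b
  simp only [Pi.smul_apply, smul_eq_mul]
  field_simp
  linear_combination -this

theorem mem_definingIdeal [Infinite k] {X : Set (PSpace k N)}
    {f : MvPolynomial (Fin (N + 1)) k} :
    f ∈ definingIdeal X ↔ ∀ p ∈ X, f ∈ lineIdeal p.rep := by
  constructor
  · intro h p hp
    rw [mem_lineIdeal]
    -- The factor `X` absorbs the parameter `0`, where the line meets the origin and `definingIdeal`
    -- imposes no condition.
    have h0 : Polynomial.X * lineHom p.rep f = 0 := by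
      refine Polynomial.funext fun c => ?_
      rw [Polynomial.eval_mul, Polynomial.eval_X, Polynomial.eval_zero, eval_lineHom]
      by_cases hc : c = 0
      · rw [hc, zero_mul]
      · have hv : c • p.rep ≠ 0 := smul_ne_zero hc p.rep_nonzero
        have := h (c • p.rep) ⟨hv, by
          convert! hp
          conv_rhs => rw [← p.mk_rep]
          exact (Projectivization.mk_eq_mk_iff' _ _ _ _ _).2 ⟨c, rfl⟩⟩
        rw [aeval_eq_eval] at this
        rw [this, mul_zero]
    exact (mul_eq_zero.1 h0).resolve_left Polynomial.X_ne_zero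
  · rintro h v ⟨hv, hX⟩
    obtain ⟨a, ha⟩ := Projectivization.exists_smul_eq_mk_rep k v hv
    have h1 := mem_lineIdeal.1 (h _ hX)
    have h2 : v = (↑a⁻¹ : k) • (Projectivization.mk k v hv).rep := by
      rw [← ha, Units.smul_def, smul_smul, Units.inv_mul, one_smul]
    rw [aeval_eq_eval, h2, ← eval_lineHom, h1, Polynomial.eval_zero]

theorem exists_mem_lineIdeal_notMem {p q : PSpace k N} (h : p ≠ q) :
    ∃ g ∈ lineIdeal q.rep, g ∉ lineIdeal p.rep := by
  obtain ⟨a, b, hab⟩ := exists_rep_mul_rep_ne h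
  refine ⟨C (q.rep b) * X a - C (q.rep a) * X b, ?_, ?_⟩
  · rw [mem_lineIdeal]
    simp only [lineHom, map_sub, map_mul, aeval_X, algHom_C, Polynomial.algebraMap_eq]
    ring
  · rw [mem_lineIdeal]
    intro h0
    apply hab
    have := congrArg (Polynomial.eval 1) h0
    simp only [lineHom, map_sub, map_mul, aeval_X, algHom_C, Polynomial.algebraMap_eq,
      Polynomial.eval_sub, Polynomial.eval_mul, Polynomial.eval_C, Polynomial.eval_X,
      Polynomial.eval_zero] at this
    linear_combination this

/-- A product `G` of forms separating `p` from the other points vanishes at all of them but not at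
`p`, so the annihilator of its class is exactly the prime of `p`. -/
theorem lineIdeal_mem_associatedPrimes [Infinite k] {X : Set (PSpace k N)} (hX : X.Finite)
    {p : PSpace k N} (hp : p ∈ X) :
    lineIdeal p.rep ∈ associatedPrimes (MvPolynomial (Fin (N + 1)) k)
      (MvPolynomial (Fin (N + 1)) k ⧸ definingIdeal X) := by
  classical
  have hsep : ∀ q : PSpace k N, ∃ g, q ≠ p → g ∈ lineIdeal q.rep ∧ g ∉ lineIdeal p.rep := by
    intro q
    by_cases h : q = p
    · exact ⟨0, fun h' => absurd h h'⟩
    · obtain ⟨g, hg⟩ := exists_mem_lineIdeal_notMem (Ne.symm h)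
      exact ⟨g, fun _ => hg⟩
  choose g hg using hsep
  set G := ∏ q ∈ hX.toFinset.erase p, g q with hG
  have hGp : G ∉ lineIdeal p.rep := by
    intro h
    obtain ⟨q, hq, h⟩ := (Ideal.IsPrime.prod_mem_iff (hp := lineIdeal_isPrime p.rep)).1 h
    exact (hg q (Finset.ne_of_mem_erase hq)).2 h
  have hGq : ∀ q ∈ X, q ≠ p → G ∈ lineIdeal q.rep := fun q hq hqp =>
    Ideal.mem_of_dvd _ (Finset.dvd_prod_of_mem g
      (Finset.mem_erase.2 ⟨hqp, hX.mem_toFinset.2 hq⟩)) (hg q hqp).1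
  rw [AssociatedPrimes.mem_iff, isAssociatedPrime_iff]
  refine ⟨inferInstance, Ideal.Quotient.mk _ G, ?_⟩
  ext s
  rw [Submodule.mem_colon_singleton, Submodule.mem_bot, ← Ideal.Quotient.mk_eq_mk,
    ← Submodule.Quotient.mk_smul, Submodule.Quotient.mk_eq_zero, smul_eq_mul, mem_definingIdeal]
  constructor
  · intro hs q hq
    by_cases hqp : q = p
    · exact hqp ▸ Ideal.mul_mem_right _ _ hs
    · exact Ideal.mul_mem_left _ _ (hGq q hq hqp)
  · intro h
    exact ((lineIdeal_isPrime p.rep).mem_or_mem (h p hp)).resolve_right hGp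

theorem vanishesToOrder_of_mem_symbolicPower [Infinite k] {X : Set (PSpace k N)}
    (hX : X.Finite) {p : PSpace k N} (hp : p ∈ X) {m : ℕ} {f : MvPolynomial (Fin (N + 1)) k}
    (hf : f ∈ symbolicPower (definingIdeal X) m) : VanishesToOrder (lineIdeal p.rep) m f := by
  obtain ⟨s, hs, h⟩ :=
    exists_mul_mem_pow_of_mem_symbolicPower (lineIdeal_mem_associatedPrimes hX hp) hf
  have hle : definingIdeal X ≤ lineIdeal p.rep := fun _ hg => mem_definingIdeal.1 hg p hp
  exact (vanishesToOrder_of_mem_pow (Ideal.pow_right_mono hle m h)).of_mul hs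

end SymbolicPower

end Chudnovsky

namespace Chudnovsky

/-! ### The Zariski topology on `(ℙ^N)^n` and its symmetric product -/

section Topology

open MvPolynomial

variable {k : Type*} [Field k] {n N : ℕ}

theorem isMultihomogeneous_one :
    IsMultihomogeneous (1 : MvPolynomial (Fin n × Fin (N + 1)) k) fun _ => 0 :=
  fun _ => isWeightedHomogeneous_one _ _

theorem IsMultihomogeneous.mul {f g : MvPolynomial (Fin n × Fin (N + 1)) k} {d e : Fin n → ℕ}
    (hf : IsMultihomogeneous f d) (hg : IsMultihomogeneous g e) :
    IsMultihomogeneous (f * g) fun i => d i + e i :=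
  fun i => (hf i).mul (hg i)

theorem isMultihomogeneous_X (ij : Fin n × Fin (N + 1)) :
    IsMultihomogeneous (X ij : MvPolynomial (Fin n × Fin (N + 1)) k)
      fun l => if ij.1 = l then 1 else 0 :=
  fun _ => isWeightedHomogeneous_X _ _ _

theorem isMultihomogeneous_rename {F : MvPolynomial (Fin (N + 1)) k} {d : ℕ}
    (hF : F.IsHomogeneous d) (i : Fin n) :
    IsMultihomogeneous (rename (Prod.mk i) F) fun l => if i = l then d else 0 := by
  intro l e he
  obtain ⟨u, rfl, hu⟩ := coeff_rename_ne_zero _ _ _ he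
  rw [Finsupp.weight_apply, Finsupp.sum_mapDomain_index (by simp) (fun _ _ _ => by rw [add_smul])]
  dsimp only
  split_ifs with h
  · have := hF hu
    rw [Finsupp.weight_apply] at this
    simpa using this
  · simp

/-- The multidegree of an entry depends only on its row, and every Leibniz term takes one entry from
each row. -/
theorem isMultihomogeneous_det {A : Type*} [Fintype A] [DecidableEq A]
    (M : Matrix A A (MvPolynomial (Fin n × Fin (N + 1)) k)) (d : A → Fin n → ℕ)
    (hM : ∀ a b, IsMultihomogeneous (M a b) (d a)) :
    IsMultihomogeneous M.det fun i => ∑ a, d a i := by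
  intro i
  rw [Matrix.det_apply]
  refine IsWeightedHomogeneous.sum _ _ _ fun s _ => ?_
  rw [Units.smul_def]
  rw [← mem_weightedHomogeneousSubmodule]
  refine zsmul_mem ?_ _
  dsimp only
  rw [mem_weightedHomogeneousSubmodule, ← Equiv.sum_comp s]
  exact IsWeightedHomogeneous.prod _ _ _ fun a _ => hM (s a) a i

theorem eval_mul_of_isMultihomogeneous {f : MvPolynomial (Fin n × Fin (N + 1)) k}
    {d : Fin n → ℕ} (hf : IsMultihomogeneous f d) (c : Fin n → k)
    (v : Fin n × Fin (N + 1) → k) :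
    eval (fun ij => c ij.1 * v ij) f = (∏ i, c i ^ d i) * eval v f := by
  rw [eval_eq', eval_eq', Finset.mul_sum]
  refine Finset.sum_congr rfl fun e he => ?_
  simp only [mul_pow, Finset.prod_mul_distrib]
  have h : ∏ ij : Fin n × Fin (N + 1), c ij.1 ^ e ij = ∏ i, c i ^ d i := by
    rw [Fintype.prod_prod_type]
    refine Finset.prod_congr rfl fun i _ => ?_
    dsimp only
    rw [Finset.prod_pow_eq_pow_sum]
    congr 1
    have := hf i (mem_support_iff.1 he)
    rw [Finsupp.weight_apply, Finsupp.sum_fintype _ _ (by simp), Fintype.sum_prod_type,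
      Finset.sum_eq_single i (by intro l _ hl; simp [hl]) (by simp)] at this
    simpa using this
  rw [h]
  ring

theorem basicOpen_one : basicOpen (1 : MvPolynomial (Fin n × Fin (N + 1)) k) = Set.univ := by
  simp [basicOpen]

theorem basicOpen_mul (f g : MvPolynomial (Fin n × Fin (N + 1)) k) :
    basicOpen (f * g) = basicOpen f ∩ basicOpen g := by
  ext P
  simp [basicOpen]

theorem isOpen_basicOpen {f : MvPolynomial (Fin n × Fin (N + 1)) k} {d : Fin n → ℕ}
    (hf : IsMultihomogeneous f d) : @IsOpen _ (zariskiTopologyProd k n N) (basicOpen f) :=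
  TopologicalSpace.isOpen_generateFrom_of_mem ⟨f, d, hf, rfl⟩

theorem isOpen_of_forall_basicOpen {S : Set (Fin n → PSpace k N)}
    (h : ∀ P ∈ S, ∃ (f : MvPolynomial (Fin n × Fin (N + 1)) k) (d : Fin n → ℕ),
      IsMultihomogeneous f d ∧ P ∈ basicOpen f ∧ basicOpen f ⊆ S) :
    @IsOpen _ (zariskiTopologyProd k n N) S := by
  let _ := zariskiTopologyProd k n N
  rw [isOpen_iff_forall_mem_open]
  intro P hP
  obtain ⟨f, d, hf, hPf, hS⟩ := h P hP
  exact ⟨_, hS, isOpen_basicOpen hf, hPf⟩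

theorem exists_basicOpen_subset {S : Set (Fin n → PSpace k N)}
    (hS : @IsOpen _ (zariskiTopologyProd k n N) S) {P : Fin n → PSpace k N} (hP : P ∈ S) :
    ∃ (f : MvPolynomial (Fin n × Fin (N + 1)) k) (d : Fin n → ℕ),
      IsMultihomogeneous f d ∧ P ∈ basicOpen f ∧ basicOpen f ⊆ S := by
  let _ := zariskiTopologyProd k n N
  have hb := TopologicalSpace.isTopologicalBasis_of_subbasis_of_inter
    (t := zariskiTopologyProd k n N) (r := {B | ∃ (f : MvPolynomial (Fin n × Fin (N + 1)) k)
      (d : Fin n → ℕ), IsMultihomogeneous f d ∧ B = basicOpen f}) rfl (by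
    rintro _ ⟨f, d, hf, rfl⟩ _ ⟨g, e, hg, rfl⟩
    exact ⟨f * g, _, hf.mul hg, (basicOpen_mul f g).symm⟩)
  obtain ⟨B, hB, hPB, hBS⟩ := hb.exists_subset_of_mem_open hP hS
  obtain rfl | ⟨f, d, hf, rfl⟩ := hB
  · exact ⟨1, _, isMultihomogeneous_one, by rwa [basicOpen_one], by rwa [basicOpen_one]⟩
  · exact ⟨f, d, hf, hPB, hBS⟩

theorem basicOpen_nonempty [Infinite k] {f : MvPolynomial (Fin n × Fin (N + 1)) k}
    {d : Fin n → ℕ} (hf : IsMultihomogeneous f d) (h0 : f ≠ 0) : (basicOpen f).Nonempty := by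
  -- The extra factors force each block of coordinates at the chosen nonvanishing point to be
  -- nonzero, hence to define a point of `ℙ^N`.
  have h1 : f * ∏ i : Fin n, X (i, 0) ≠ 0 :=
    mul_ne_zero h0 (Finset.prod_ne_zero_iff.2 fun i _ => X_ne_zero _)
  obtain ⟨v, hv⟩ : ∃ v, eval v (f * ∏ i : Fin n, X (i, 0)) ≠ 0 := by
    by_contra! h
    exact h1 (MvPolynomial.funext fun v => by rw [h, map_zero])
  rw [map_mul, map_prod, mul_ne_zero_iff, Finset.prod_ne_zero_iff] at hv
  have hvi : ∀ i : Fin n, (fun j => v (i, j)) ≠ 0 := fun i h =>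
    hv.2 i (Finset.mem_univ _) (by rw [eval_X]; exact congrFun h 0)
  choose a ha using fun i => Projectivization.exists_smul_eq_mk_rep k _ (hvi i)
  refine ⟨fun i => Projectivization.mk k _ (hvi i), ?_⟩
  have : (fun ij : Fin n × Fin (N + 1) => (Projectivization.mk k _ (hvi ij.1)).rep ij.2) =
      fun ij => (a ij.1 : k) * v ij := by
    funext ij
    rw [← ha]
    rfl
  change eval _ f ≠ 0
  rw [this, eval_mul_of_isMultihomogeneous hf (fun i => (a i : k)) v]
  exact mul_ne_zero (Finset.prod_ne_zero_iff.2 fun i _ => pow_ne_zero _ (a i).ne_zero) hv.1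

/-- The variety `(ℙ^N)^n` is irreducible. -/
theorem inter_nonempty_of_isOpen [Infinite k] {S T : Set (Fin n → PSpace k N)}
    (hS : @IsOpen _ (zariskiTopologyProd k n N) S) (hT : @IsOpen _ (zariskiTopologyProd k n N) T)
    (hS' : S.Nonempty) (hT' : T.Nonempty) : (S ∩ T).Nonempty := by
  obtain ⟨P, hP⟩ := hS'
  obtain ⟨Q, hQ⟩ := hT'
  obtain ⟨f, d, hf, hPf, hfS⟩ := exists_basicOpen_subset hS hP
  obtain ⟨g, e, hg, hQg, hgT⟩ := exists_basicOpen_subset hT hQ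
  have hf0 : f ≠ 0 := by rintro rfl; exact hPf (map_zero _)
  have hg0 : g ≠ 0 := by rintro rfl; exact hQg (map_zero _)
  refine (basicOpen_nonempty (hf.mul hg) (mul_ne_zero hf0 hg0)).mono ?_
  rw [basicOpen_mul]
  exact Set.inter_subset_inter hfS hgT

theorem cycle_surjective : Function.Surjective (cycle : (Fin n → PSpace k N) → _) := by
  rintro ⟨s, hs⟩
  have hl : s.toList.length = n := by rw [Multiset.length_toList, hs]
  refine ⟨fun i => s.toList.get (i.cast hl.symm), Subtype.ext ?_⟩
  subst hl
  change Multiset.map (fun i => s.toList.get i) (Finset.univ : Finset (Fin _)).val = s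
  rw [Fin.univ_val_map, List.ofFn_get, Multiset.coe_toList]

theorem mem_cycle {P : Fin n → PSpace k N} {p : PSpace k N} : p ∈ cycle P ↔ ∃ i, P i = p := by
  change p ∈ Multiset.map P Finset.univ.val ↔ _
  simp

theorem nodup_cycle {P : Fin n → PSpace k N} :
    (cycle P : Multiset (PSpace k N)).Nodup ↔ Function.Injective P := by
  change (Multiset.map P Finset.univ.val).Nodup ↔ _
  rw [Multiset.nodup_map_iff_inj_on (Finset.univ : Finset (Fin n)).nodup]
  simp [Function.Injective]

theorem dense_of_isOpen_sym [Infinite k] {U : Set (Sym (PSpace k N) n)}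
    (hU : @IsOpen _ (zariskiTopologySym k n N) U) (hU' : U.Nonempty) :
    @Dense _ (zariskiTopologySym k n N) U := by
  let _ := zariskiTopologySym k n N
  rw [dense_iff_inter_open]
  intro V hV hV'
  obtain ⟨P, hPV, hPU⟩ := inter_nonempty_of_isOpen (isOpen_coinduced.1 hV) (isOpen_coinduced.1 hU)
    (hV'.preimage cycle_surjective) (hU'.preimage cycle_surjective)
  exact ⟨cycle P, hPV, hPU⟩

theorem isOpen_injective :
    @IsOpen _ (zariskiTopologyProd k n N) {P | Function.Injective P} := by
  let _ := zariskiTopologyProd k n N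
  have h : {P : Fin n → PSpace k N | Function.Injective P} =
      ⋂ i, ⋂ j, {P | P i = P j → i = j} := by
    ext P
    simp [Function.Injective]
  rw [h]
  refine isOpen_iInter_of_finite fun i => isOpen_iInter_of_finite fun j => ?_
  by_cases hij : i = j
  · simp [hij]
  refine isOpen_of_forall_basicOpen fun P hP => ?_
  have hP : P i ≠ P j := fun h => hij (hP h)
  -- Two points differ exactly when some `2 × 2` minor of their coordinates is nonzero, and that
  -- minor is bihomogeneous.
  obtain ⟨a, b, hab⟩ := exists_rep_mul_rep_ne hP
  refine ⟨X (i, a) * X (j, b) - X (i, b) * X (j, a), _, fun l =>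
    (((isMultihomogeneous_X (i, a)).mul (isMultihomogeneous_X (j, b))) l).sub
      (((isMultihomogeneous_X (i, b)).mul (isMultihomogeneous_X (j, a))) l), ?_, ?_⟩
  · simpa [basicOpen] using hab
  · intro Q hQ h
    refine absurd ?_ hQ
    simp [h, mul_comm]

end Topology

/-! ### Linear conditions on forms of fixed degree -/

section Forms

open MvPolynomial

variable {k : Type*} [Field k] {n N : ℕ}

/-- The exponents of the monomials of degree `D` in `N + 1` variables. -/
abbrev Exponents (N D : ℕ) : Type :=
  ((Finset.univ : Finset (Fin (N + 1))).finsuppAntidiag D : Finset (Fin (N + 1) →₀ ℕ))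

theorem degree_exponents {D : ℕ} (a : Exponents N D) : a.1.degree = D := by
  rw [Finsupp.degree_eq_sum]
  exact (Finset.mem_finsuppAntidiag.1 a.2).1

/-- The form of degree `D` with given coefficients. -/
noncomputable def formOfCoeffs (k : Type*) [Field k] (N D : ℕ) :
    (Exponents N D → k) →ₗ[k] MvPolynomial (Fin (N + 1)) k :=
  ∑ a, (monomial a.1).comp (LinearMap.proj a)

theorem formOfCoeffs_apply {D : ℕ} (c : Exponents N D → k) :
    formOfCoeffs k N D c = ∑ a, c a • monomial a.1 1 := by
  simp [formOfCoeffs, smul_monomial]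

theorem formOfCoeffs_isHomogeneous {D : ℕ} (c : Exponents N D → k) :
    (formOfCoeffs k N D c).IsHomogeneous D := by
  rw [formOfCoeffs_apply]
  refine IsHomogeneous.sum _ _ _ fun a _ => ?_
  rw [smul_monomial]
  exact isHomogeneous_monomial _ (degree_exponents a)

theorem coeff_formOfCoeffs {D : ℕ} (c : Exponents N D → k) (a : Exponents N D) :
    coeff a.1 (formOfCoeffs k N D c) = c a := by
  classical
  rw [formOfCoeffs_apply, coeff_sum, Finset.sum_eq_single a]
  · simp
  · intro b _ hb
    simp [coeff_monomial, Subtype.ext_iff.not.1 hb]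
  · simp

theorem formOfCoeffs_injective (D : ℕ) : Function.Injective (formOfCoeffs k N D) :=
  fun c c' h => _root_.funext fun a => by rw [← coeff_formOfCoeffs c, h, coeff_formOfCoeffs]

theorem exists_formOfCoeffs_eq {D : ℕ} {F : MvPolynomial (Fin (N + 1)) k}
    (hF : F.IsHomogeneous D) : ∃ c, formOfCoeffs k N D c = F := by
  refine ⟨fun a => coeff a.1 F, ?_⟩
  ext d
  by_cases hd : d.degree = D
  · exact coeff_formOfCoeffs _ (⟨d, Finset.mem_finsuppAntidiag.2
      ⟨by rw [← hd, Finsupp.degree_eq_sum], Finset.subset_univ _⟩⟩ : Exponents N D)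
  · rw [(formOfCoeffs_isHomogeneous _).coeff_eq_zero hd, hF.coeff_eq_zero hd]

/-- If only `0` satisfies all the equations, the rows span the dual space, so a basis can be chosen
among them; it gives a nonzero maximal minor. -/
theorem exists_det_ne_zero {A ι : Type*} [Fintype A] [DecidableEq A] (ρ : ι → A → k)
    (h : ∀ c : A → k, (∀ i, ∑ a, c a * ρ i a = 0) → c = 0) :
    ∃ r : A → ι, (Matrix.of fun a b => ρ (r a) b).det ≠ 0 := by
  have hspan : Submodule.span k (Set.range ρ) = ⊤ := by
    by_contra hne
    obtain ⟨φ, hφ, hle⟩ := Submodule.exists_le_ker_of_lt_top _ (lt_top_iff_ne_top.2 hne)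
    refine hφ (LinearMap.pi_ext' fun a => LinearMap.ext_ring ?_)
    have := h (fun a => φ (Pi.single a 1)) fun i => by
      have h0 : φ (ρ i) = 0 := hle (Submodule.subset_span ⟨i, rfl⟩)
      rw [LinearMap.pi_apply_eq_sum_univ] at h0
      rw [← h0]
      refine Finset.sum_congr rfl fun a _ => ?_
      rw [smul_eq_mul, mul_comm]
      congr 2
      ext b
      simp [Pi.single_apply, eq_comm]
    exact congrFun this a
  obtain ⟨κ, s, -, hs, hli⟩ := exists_linearIndependent' k ρ
  have b := Module.Basis.mk hli (by rw [hs, hspan])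
  let e : A ≃ κ := (Pi.basisFun k A).indexEquiv b
  refine ⟨s ∘ e, ?_⟩
  have h2 : LinearIndependent k (Matrix.of fun a b => ρ ((s ∘ e) a) b).row :=
    hli.comp e e.injective
  rw [Matrix.linearIndependent_rows_iff_isUnit, Matrix.isUnit_iff_isUnit_det] at h2
  exact h2.ne_zero

/-- No nonzero form of degree `D` vanishes to order `m` at all points of `X`. -/
def NoFormVanishing (X : Set (PSpace k N)) (m D : ℕ) : Prop :=
  ∀ F : MvPolynomial (Fin (N + 1)) k, F.IsHomogeneous D →
    (∀ p ∈ X, VanishesToOrder (lineIdeal p.rep) m F) → F = 0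

theorem isOpen_noFormVanishing (m D : ℕ) : @IsOpen _ (zariskiTopologyProd k n N)
    {P | NoFormVanishing (Set.range P) m D} := by
  classical
  refine isOpen_of_forall_basicOpen fun P hP => ?_
  -- One linear condition on the coefficients for each point and each word of derivatives of length
  -- less than `m`.
  let ι := Fin n × {w : List (Fin (N + 1)) // w.length < m}
  have hvan : ∀ (Q : Fin n → PSpace k N) (c : Exponents N D → k) (i : ι),
      iterPderiv i.2.1 (formOfCoeffs k N D c) ∈ lineIdeal (Q i.1).rep ↔
        ∑ a, c a * eval (Q i.1).rep (iterPderiv i.2.1 (monomial a.1 1)) = 0 := by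
    intro Q c i
    rw [mem_lineIdeal_of_isHomogeneous (iterPderiv_isHomogeneous _ (formOfCoeffs_isHomogeneous c)),
      formOfCoeffs_apply, map_sum, map_sum]
    simp only [map_smul, smul_eval]
  obtain ⟨r, hr⟩ := exists_det_ne_zero
    (fun (i : ι) (a : Exponents N D) => eval (P i.1).rep (iterPderiv i.2.1 (monomial a.1 1))) (by
      intro c hc
      refine formOfCoeffs_injective D ?_
      rw [map_zero]
      refine hP _ (formOfCoeffs_isHomogeneous c) ?_
      rintro _ ⟨i, rfl⟩ w hw
      exact (hvan P c (i, ⟨w, hw⟩)).2 (hc _))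
  -- The minor that is nonzero at `P`, with the points made variable. Its nonvanishing locus is the
  -- required neighbourhood, since the same conditions still force all coefficients to vanish.
  set M : Matrix (Exponents N D) (Exponents N D) (MvPolynomial (Fin n × Fin (N + 1)) k) :=
    Matrix.of fun a b => rename (Prod.mk (r a).1) (iterPderiv (r a).2.1 (monomial b.1 1)) with hM
  have heval : ∀ Q : Fin n → PSpace k N, eval (fun ij => (Q ij.1).rep ij.2) M.det =
      (Matrix.of fun a b : Exponents N D =>
        eval (Q (r a).1).rep (iterPderiv (r a).2.1 (monomial b.1 1))).det := by
    intro Q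
    rw [RingHom.map_det]
    congr 1
    ext a b
    simp only [hM, RingHom.mapMatrix_apply, Matrix.map_apply, Matrix.of_apply, eval_rename]
    rfl
  refine ⟨M.det, _, isMultihomogeneous_det M
    (fun a l => if (r a).1 = l then D - (r a).2.1.length else 0) fun a b =>
      isMultihomogeneous_rename (iterPderiv_isHomogeneous _
        (isHomogeneous_monomial _ (degree_exponents b))) _, ?_, ?_⟩
  · change eval _ _ ≠ 0
    rwa [heval]
  · intro Q hQ F hF hvF
    obtain ⟨c, rfl⟩ := exists_formOfCoeffs_eq hF
    have hQ' : eval (fun ij => (Q ij.1).rep ij.2) M.det ≠ 0 := hQ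
    rw [heval] at hQ'
    have hc : c = 0 := by
      refine Matrix.eq_zero_of_mulVec_eq_zero hQ' (_root_.funext fun a => ?_)
      have := (hvan Q c (r a)).1 (hvF _ ⟨_, rfl⟩ _ (r a).2.2)
      simpa [Matrix.mulVec, dotProduct, mul_comm] using this
    rw [hc, map_zero]

theorem exists_form_mem_lineIdeal {β : ℕ} (h : n < (N + β).choose N) (P : Fin n → PSpace k N) :
    ∃ F : MvPolynomial (Fin (N + 1)) k, F.IsHomogeneous β ∧ F ≠ 0 ∧
      ∀ i, F ∈ lineIdeal (P i).rep := by
  let φ : (Exponents N β → k) →ₗ[k] (Fin n → k) :=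
    LinearMap.pi fun i => (aeval (P i).rep).toLinearMap ∘ₗ formOfCoeffs k N β
  have hker : LinearMap.ker φ ≠ ⊥ := by
    refine φ.ker_ne_bot_of_finrank_lt ?_
    rw [Module.finrank_fintype_fun_eq_card, Module.finrank_fintype_fun_eq_card, Fintype.card_fin,
      Fintype.card_coe, Finset.card_finsuppAntidiag_nat_eq_choose, Finset.card_univ,
      Fintype.card_fin, Nat.add_right_comm, Nat.add_sub_cancel, ← Nat.choose_symm_add]
    exact h
  obtain ⟨c, hc, hc0⟩ := Submodule.exists_mem_ne_zero_of_ne_bot hker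
  refine ⟨_, formOfCoeffs_isHomogeneous c, fun h0 => hc0 (formOfCoeffs_injective β ?_), fun i => ?_⟩
  · rw [h0, map_zero]
  · rw [mem_lineIdeal_of_isHomogeneous (formOfCoeffs_isHomogeneous c), ← aeval_eq_eval]
    exact congrFun (LinearMap.mem_ker.1 hc) i

end Forms

end Chudnovsky

/-! ### The special configuration and the main theorem -/

namespace Chudnovsky

open MvPolynomial

variable {k : Type*} [Field k] {n N : ℕ}

theorem infinite_projectiveSpace [Infinite k] (hN : 1 ≤ N) : Infinite (PSpace k N) := by
  have h0 : ∀ c : k, (fun j : Fin (N + 1) => c ^ (j : ℕ)) ≠ 0 := fun c h => by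
    simpa using congrFun h 0
  refine Infinite.of_injective (fun c : k => Projectivization.mk k _ (h0 c)) fun c d h => ?_
  obtain ⟨a, ha⟩ := (Projectivization.mk_eq_mk_iff' _ _ _ _ _).1 h
  have h1 := congrFun ha 0
  have h2 := congrFun ha (⟨1, by omega⟩ : Fin (N + 1))
  simp only [Pi.smul_apply, smul_eq_mul, Fin.val_zero, pow_zero, pow_one, mul_one] at h1 h2
  rw [h1, one_mul] at h2
  exact h2.symm

theorem starPoint_ne_zero {S : Finset k} (hS : S.card = N) : starPoint N S ≠ 0 := by
  intro h
  have h1 := congrFun h (Fin.last N)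
  have h2 : (∏ a ∈ S, (Polynomial.X - Polynomial.C a)).Monic :=
    Polynomial.monic_prod_of_monic _ _ fun a _ => Polynomial.monic_X_sub_C a
  rw [Polynomial.Monic, Polynomial.leadingCoeff, natDegree_prod_X_sub_C, hS] at h2
  simp [starPoint, h2] at h1

theorem lineIdeal_rep_mk_le [Infinite k] {v : Fin (N + 1) → k} (hv : v ≠ 0) :
    lineIdeal (Projectivization.mk k v hv).rep ≤ lineIdeal v := by
  intro f hf
  obtain ⟨a, ha⟩ := Projectivization.exists_smul_eq_mk_rep k v hv
  have h2 : v = (↑a⁻¹ : k) • (Projectivization.mk k v hv).rep := by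
    rw [← ha, Units.smul_def, smul_smul, Units.inv_mul, one_smul]
  rw [mem_lineIdeal] at hf ⊢
  refine Polynomial.funext fun c => ?_
  rw [eval_lineHom, h2, smul_smul, ← eval_lineHom, hf, Polynomial.eval_zero, Polynomial.eval_zero]

theorem VanishesToOrder.of_le {σ : Type*} {P Q : Ideal (MvPolynomial σ k)} {m : ℕ}
    {f : MvPolynomial σ k} (h : VanishesToOrder P m f) (hPQ : P ≤ Q) : VanishesToOrder Q m f :=
  fun w hw => hPQ (h w hw)

theorem exists_starConfiguration [CharZero k] (hN : 1 ≤ N) {s : ℕ} (hNs : N ≤ s)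
    (hs : s.choose N ≤ n) : ∃ P : Fin n → PSpace k N, Function.Injective P ∧
      ∀ m D : ℕ, 1 ≤ m → N * D < m * s → NoFormVanishing (Set.range P) m D := by
  classical
  have : Infinite k := CharZero.infinite k
  have := infinite_projectiveSpace (k := k) hN
  obtain ⟨T, hT⟩ := Infinite.exists_subset_card_eq k s
  let pt : {S // S ∈ T.powersetCard N} → PSpace k N := fun S =>
    Projectivization.mk k _ (starPoint_ne_zero (Finset.mem_powersetCard.1 S.2).2)
  -- Extra points only add vanishing conditions, so padding the star configuration to `n` points
  -- preserves the bound. Distinctness of the star points themselves is not needed.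
  obtain ⟨Z, hZ, hZn⟩ := Infinite.exists_superset_card_eq (Finset.univ.image pt) n (by
    refine Finset.card_image_le.trans ?_
    rwa [Finset.card_univ, Fintype.card_coe, Finset.card_powersetCard, hT])
  let e : Fin n ≃ Z := (Z.equivFinOfCardEq hZn).symm
  refine ⟨fun i => e i, Subtype.val_injective.comp e.injective, fun m D hm hD F hF hvan => ?_⟩
  by_contra hF0
  refine absurd ((mul_card_le_of_starConfiguration N T m F (hT ▸ hNs) hm hF0 fun S hS hSN => ?_).2)
    (by rw [hT, hF.totalDegree hF0]; omega)
  have hS' : S ∈ T.powersetCard N := Finset.mem_powersetCard.2 ⟨hS, hSN⟩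
  have hp : pt ⟨S, hS'⟩ ∈ Z := hZ (Finset.mem_image_of_mem _ (Finset.mem_univ _))
  exact ((hvan _ ⟨e.symm ⟨_, hp⟩, by simp [pt]⟩).of_le
    (lineIdeal_rep_mk_le (starPoint_ne_zero hSN))).X_pow_dvd_taylorLine

theorem initialDegree_le {I : Ideal (MvPolynomial (Fin (N + 1)) k)}
    {f : MvPolynomial (Fin (N + 1)) k} (hf : f ∈ I) (hf0 : f ≠ 0) :
    initialDegree I ≤ f.totalDegree :=
  Nat.sInf_le ⟨f, hf, hf0, rfl⟩

theorem exists_totalDegree_eq_initialDegree {I : Ideal (MvPolynomial (Fin (N + 1)) k)}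
    (hI : I ≠ ⊥) : ∃ f ∈ I, f ≠ 0 ∧ f.totalDegree = initialDegree I := by
  obtain ⟨f, hf, hf0⟩ := Submodule.exists_mem_ne_zero_of_ne_bot hI
  exact Nat.sInf_mem (s := {d : ℕ | ∃ f ∈ I, f ≠ 0 ∧ f.totalDegree = d}) ⟨_, f, hf, hf0, rfl⟩

/-- If no nonzero form of degree `D` vanishes to order `m` on `X`, then every nonzero element of
`I_X^(m)` has degree greater than `D`. -/
theorem NoFormVanishing.lt_totalDegree [Infinite k] {X : Set (PSpace k N)} (hX : X.Finite)
    {m D : ℕ} (h : NoFormVanishing X m D) {f : MvPolynomial (Fin (N + 1)) k}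
    (hf : f ∈ symbolicPower (definingIdeal X) m) (hf0 : f ≠ 0) : D < f.totalDegree := by
  by_contra! hle
  have htop : homogeneousComponent f.totalDegree f ≠ 0 := by
    obtain ⟨d, hd, hdeg⟩ := Finset.exists_mem_eq_sup f.support (support_nonempty.2 hf0)
      fun s => s.sum fun _ e => e
    have hdeg' : d.degree = f.totalDegree := hdeg.symm
    intro h0
    have := congrArg (coeff d) h0
    rw [coeff_homogeneousComponent, if_pos hdeg', coeff_zero] at this
    exact mem_support_iff.1 hd this
  -- The top component of `f`, multiplied by a power of `x_0`, becomes a form of degree exactly `D`;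
  -- thus one degree `D` controls all smaller ones.
  have hhom := (isHomogeneous_X_pow (R := k) (0 : Fin (N + 1)) (D - f.totalDegree)).mul
    (homogeneousComponent_isHomogeneous f.totalDegree f)
  rw [Nat.sub_add_cancel hle] at hhom
  exact mul_ne_zero (pow_ne_zero _ (X_ne_zero _)) htop (h _ hhom fun p hp =>
    ((vanishesToOrder_of_mem_symbolicPower hX hp hf).homogeneousComponent _).mul_left _)

theorem exists_choose_le_lt (hN : 1 ≤ N) (hn : 1 ≤ n) :
    ∃ β, 1 ≤ β ∧ (N + β - 1).choose N ≤ n ∧ n < (N + β).choose N := by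
  have hex : ∃ β, n < (N + β).choose N := by
    refine ⟨n, ?_⟩
    rw [Nat.choose_symm_add]
    calc n < n + 1 := n.lt_succ_self
      _ = (1 + n).choose n := by rw [add_comm 1 n, Nat.choose_succ_self_right]
      _ ≤ _ := Nat.choose_le_choose _ (by omega)
  refine ⟨Nat.find hex, ?_, ?_, Nat.find_spec hex⟩
  · rw [Nat.one_le_iff_ne_zero]
    intro h
    have := Nat.find_spec hex
    rw [h, add_zero, Nat.choose_self] at this
    omega
  · have hpos : Nat.find hex ≠ 0 := by
      intro h
      have := Nat.find_spec hex
      rw [h, add_zero, Nat.choose_self] at this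
      omega
    have := Nat.find_min hex (m := Nat.find hex - 1) (by omega)
    rw [Nat.add_sub_assoc (by omega)]
    omega

end Chudnovsky

open Chudnovsky in
theorem theorem2p6 {k : Type*} [Field k] [IsAlgClosed k] [CharZero k]
    (N n : ℕ) (hN : 1 ≤ N) (hn : 1 ≤ n) :
    Chudnovsky.HoldsForVeryGeneralPoints k n N fun z =>
      (z : Multiset (Chudnovsky.PSpace k N)).Nodup ∧
        Chudnovsky.SatisfiesChudnovsky (Chudnovsky.definingIdeal {p | p ∈ z}) := by
  have : Infinite k := CharZero.infinite k
  obtain ⟨β, hβ, hle, hlt⟩ := exists_choose_le_lt hN hn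
  set s := N + β - 1 with hs
  -- The largest `D` with `N * D < m * s`, where `m = i + 1`.
  let D : ℕ → ℕ := fun i => ((i + 1) * s - 1) / N
  have hrange : ∀ P : Fin n → PSpace k N, {p | p ∈ cycle P} = Set.range P := fun P =>
    Set.ext fun p => mem_cycle
  let U : ℕ → Set (Sym (PSpace k N) n) := fun i =>
    {z | (z : Multiset (PSpace k N)).Nodup ∧ NoFormVanishing {p | p ∈ z} (i + 1) (D i)}
  have hU : ∀ i, @IsOpen _ (zariskiTopologySym k n N) (U i) := by
    intro i
    let _ := zariskiTopologyProd k n N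
    rw [isOpen_coinduced]
    have h : cycle ⁻¹' U i = {P : Fin n → PSpace k N | Function.Injective P} ∩
        {P | NoFormVanishing (Set.range P) (i + 1) (D i)} := by
      ext P
      simp only [U, Set.mem_preimage, Set.mem_ofPred_eq, Set.mem_inter_iff, nodup_cycle, hrange]
    rw [h]
    exact isOpen_injective.inter (isOpen_noFormVanishing _ _)
  obtain ⟨P, hP, hstar⟩ := exists_starConfiguration (k := k) hN (s := s) (by omega) hle
  have hPU : ∀ i, cycle P ∈ U i := by
    refine fun i => ⟨nodup_cycle.2 hP, ?_⟩
    rw [hrange]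
    refine hstar _ _ (by omega) ?_
    have h1 := Nat.mul_div_le ((i + 1) * s - 1) N
    have h2 : 0 < (i + 1) * s := Nat.mul_pos (by omega) (by omega)
    change N * (((i + 1) * s - 1) / N) < _
    omega
  refine ⟨U, hU, fun i => dense_of_isOpen_sym (hU i) ⟨_, hPU i⟩, ⟨_, Set.mem_iInter.2 hPU⟩, ?_⟩
  intro z hz
  rw [Set.mem_iInter] at hz
  refine ⟨(hz 0).1, fun m hm => ?_⟩
  obtain ⟨Q, rfl⟩ := cycle_surjective z
  obtain ⟨i, rfl⟩ := Nat.exists_eq_add_of_le' hm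
  have hzi := (hz i).2
  simp only [hrange] at hzi ⊢
  obtain ⟨F, hF, hF0, hFQ⟩ := exists_form_mem_lineIdeal hlt Q
  have hFI : F ∈ definingIdeal (Set.range Q) := mem_definingIdeal.2 (by
    rintro _ ⟨j, rfl⟩
    exact hFQ j)
  have hα : initialDegree (definingIdeal (Set.range Q)) ≤ β :=
    (initialDegree_le hFI hF0).trans (hF.totalDegree hF0).le
  -- `F ^ (i + 1)` shows that the symbolic power is nonzero, so its initial degree is attained and
  -- is not the default value `sInf ∅ = 0`.
  obtain ⟨f, hf, hf0, hfd⟩ := exists_totalDegree_eq_initialDegree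
    (I := symbolicPower (definingIdeal (Set.range Q)) (i + 1)) fun h => pow_ne_zero (i + 1) hF0 (by
      rw [← Ideal.mem_bot, ← h]
      exact pow_le_symbolicPower _ _ (Ideal.pow_mem_pow hFI _))
  have hD := hzi.lt_totalDegree (Set.finite_range Q) hf hf0
  rw [hfd] at hD
  set α := initialDegree (symbolicPower (definingIdeal (Set.range Q)) (i + 1))
  have hbound : (i + 1) * s ≤ N * α := by
    have := (Nat.div_lt_iff_lt_mul hN).1 hD
    rw [mul_comm N]
    omega
  have hbound' : ((i + 1 : ℕ) : ℝ) * ((N : ℝ) + β - 1) ≤ N * α := by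
    have h1 : ((N : ℝ) + β - 1) = (s : ℕ) := by
      rw [hs, Nat.cast_sub (by omega)]
      push_cast
      ring
    rw [h1]
    exact_mod_cast hbound
  have hN' : (0 : ℝ) < N := by exact_mod_cast hN
  have hα' : (initialDegree (definingIdeal (Set.range Q)) : ℝ) ≤ β := by exact_mod_cast hα
  have hi : (0 : ℝ) < (i + 1 : ℕ) := by positivity
  rw [ge_iff_le, div_le_div_iff₀ hN' hi]
  nlinarith [mul_le_mul_of_nonneg_left hα' hi.le]
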